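/- Let $M$ be a non-empty compact complex manifold (Hausdorff, not necessarily connected) of dimension $k\ge 1$ with a smooth Hermitian metric, let $\omega$ be its fundamental form, i.e. a smooth $(1,1)$-form that is positive definite at every point, and let $\alpha_1,\dots,\alpha_{k-1}$ be continuous $(1,0)$-forms on $M$; no integrability condition is assumed. Then there exists a current $T$ of bidimension $(1,1)$ on $M$, i.e. a continuous $\mathbb C$-linear functional on the space of smooth $(1,1)$-forms, such that 1. $T$ is positive: $\langle T,\theta\rangle\ge 0$ for every smooth $(1,1)$-form $\theta$ that is positive at every point; 2. $T$ has mass $1$: $\int_M T\wedge\omega=\langle T,\omega\rangle=1$; 3. $T\wedge\alpha_j=0$ for $j=1,\dots,k-1$: $\langle T,\alpha_j\wedge\beta\rangle=0$ for every smooth $(0,1)$-form $\beta$, where $T$ is extended to the continuous $(1,1)$-forms by continuity for uniform convergence (a positive current is of order $0$); 4. $i\partial\bar\partial T=0$: $\langle T,i\partial\bar\partial u\rangle=0$ for every smooth function $u:M\to\mathbb C$. -/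

import Mathlib

open Set Filter Topology
open scoped Manifold ContDiff

noncomputable section

namespace PfaffCurrents

/-- The model space `ℂ^k`. -/
abbrev Cn (k : ℕ) : Type := EuclideanSpace ℂ (Fin k)

/-- Complex-valued `ℝ`-multilinear alternating `n`-forms on `ℂ^k`. -/
abbrev Alt (k n : ℕ) : Type := Cn k [⋀^Fin n]→L[ℝ] ℂ

section Pointwise

variable {k n : ℕ}

/-- An alternating form `a` is of type `(p,q)` if `a(λ v₁, …, λ vₙ) = λ^p (conj λ)^q a(v₁, …, vₙ)`
for all complex `λ`.  When `n = p + q` this singles out the summand `Λ^{p,q}` of `Λ^n ⊗ ℂ`. -/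
def IsType (p q : ℕ) (a : Alt k n) : Prop :=
  ∀ (c : ℂ) (v : Fin n → Cn k), a (c • v) = c ^ p * (starRingEnd ℂ c) ^ q * a v

theorem IsType.add {p q : ℕ} {a b : Alt k n} (ha : IsType p q a) (hb : IsType p q b) :
    IsType p q (a + b) := fun c v => by
  simp only [ContinuousAlternatingMap.add_apply, ha c v, hb c v]; ring

theorem IsType.zero (p q : ℕ) : IsType p q (0 : Alt k n) := fun c v => by simp

theorem IsType.smul {p q : ℕ} {a : Alt k n} (c : ℂ) (ha : IsType p q a) :
    IsType p q (c • a) := fun d v => by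
  simp only [ContinuousAlternatingMap.smul_apply, ha d v, smul_eq_mul]; ring

/-- The wedge product of two `1`-forms, `(a ∧ b)(v, w) = a(v) b(w) - a(w) b(v)`;
see `wedge_apply`. -/
def wedge (a b : Alt k 1) : Alt k 2 :=
  ContinuousAlternatingMap.alternatizeUncurryFin
    ((ContinuousLinearMap.lsmul ℝ ℂ (E := Alt k 1)).flip b ∘L
      ((ContinuousAlternatingMap.ofSubsingleton ℝ (Cn k) ℂ (0 : Fin 1)).symm a))

theorem wedge_apply (a b : Alt k 1) (v : Fin 2 → Cn k) :
    wedge a b v = a (fun _ => v 0) * b (fun _ => v 1) - a (fun _ => v 1) * b (fun _ => v 0) := by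
  simp only [wedge, ContinuousAlternatingMap.alternatizeUncurryFin_apply]
  have h0 : Fin.removeNth 0 v = fun _ => v 1 := by
    funext i; fin_cases i; rfl
  have h1 : Fin.removeNth 1 v = fun _ => v 0 := by
    funext i; fin_cases i; rfl
  simp [h0, h1, sub_eq_add_neg]

theorem IsType.wedge {a b : Alt k 1} (ha : IsType 1 0 a) (hb : IsType 0 1 b) :
    IsType 1 1 (wedge a b) := fun c v => by
  have ha' : ∀ w : Cn k, a (fun _ => c • w) = c * a (fun _ => w) := fun w => by
    simpa [Pi.smul_def] using ha c (fun _ => w)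
  have hb' : ∀ w : Cn k, b (fun _ => c • w) = starRingEnd ℂ c * b (fun _ => w) := fun w => by
    simpa [Pi.smul_def] using hb c (fun _ => w)
  simp only [wedge_apply, Pi.smul_apply, ha', hb']
  ring

theorem wedge_compContinuousLinearMap (a b : Alt k 1) (L : Cn k →L[ℝ] Cn k) :
    (PfaffCurrents.wedge a b).compContinuousLinearMap L =
      PfaffCurrents.wedge (a.compContinuousLinearMap L) (b.compContinuousLinearMap L) := by
  ext v
  simp only [wedge_apply, ContinuousAlternatingMap.compContinuousLinearMap_apply]
  rfl

theorem continuous_wedge :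
    Continuous fun x : Alt k 1 × Alt k 1 => PfaffCurrents.wedge x.1 x.2 := by
  have h := (ContinuousLinearMap.lsmul ℝ ℂ (E := Alt k 1)).flip.continuous.comp
    (continuous_snd (X := Alt k 1))
  have h' := (ContinuousAlternatingMap.ofSubsingletonLIE (𝕜 := ℝ) (E := Cn k) (F := ℂ)
    (0 : Fin 1)).symm.continuous.comp (continuous_fst (Y := Alt k 1))
  exact (ContinuousAlternatingMap.alternatizeUncurryFinCLM ℝ (Cn k) ℂ).continuous.comp
    (h.clm_comp h')

theorem continuousOn_wedge {s : Set (Cn k)} {a b : Cn k → Alt k 1} (ha : ContinuousOn a s)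
    (hb : ContinuousOn b s) : ContinuousOn (fun y => PfaffCurrents.wedge (a y) (b y)) s :=
  continuous_wedge.comp_continuousOn (f := fun y => (a y, b y)) (ha.prodMk hb)

/-- A `2`-form (to be used in type `(1,1)`) is positive if `a(v, i v) ≥ 0` for all `v`.  For
`a = i ∑ h_{jl} dz_j ∧ dz̄_l` one has `a(v, i v) = 2 ∑ h_{jl} v_j v̄_l`. -/
def IsPositiveAt (a : Alt k 2) : Prop :=
  ∀ v : Cn k, 0 ≤ (a ![v, Complex.I • v]).re ∧ (a ![v, Complex.I • v]).im = 0

/-- A `2`-form (to be used in type `(1,1)`) is positive definite if `a(v, i v) > 0` for all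
`v ≠ 0`. -/
def IsPosDefAt (a : Alt k 2) : Prop :=
  ∀ v : Cn k, v ≠ 0 → 0 < (a ![v, Complex.I • v]).re ∧ (a ![v, Complex.I • v]).im = 0

/-- The `(0,1)`-part `∂̄g` of the differential of `g : ℂ^k → ℂ`, that is
`∂̄g(v) = (Dg(v) + i Dg(i v)) / 2`. -/
def dbar (g : Cn k → ℂ) (y : Cn k) : Alt k 1 :=
  ContinuousAlternatingMap.ofSubsingleton ℝ (Cn k) ℂ (0 : Fin 1)
    ((1 / 2 : ℂ) • (fderiv ℝ g y + Complex.I •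
      (fderiv ℝ g y ∘L ((Complex.I • ContinuousLinearMap.id ℂ (Cn k)).restrictScalars ℝ))))

/-- `i∂∂̄g = i d(∂̄g)` on `ℂ^k` (recall `∂̄∂̄ = 0`). -/
def iddbarLocal (g : Cn k → ℂ) (y : Cn k) : Alt k 2 :=
  Complex.I • extDeriv (dbar g) y

theorem two_le_infty : (2 : ℕ∞ω) ≤ ∞ := by
  exact WithTop.coe_le_coe.2 (le_top : (2 : ℕ∞) ≤ ⊤)

theorem dbar_apply (g : Cn k → ℂ) (y : Cn k) (v : Fin 1 → Cn k) :
    dbar g y v = 1 / 2 * (fderiv ℝ g y (v 0) + Complex.I * fderiv ℝ g y (Complex.I • v 0)) := by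
  simp [dbar, mul_add]

theorem dbar_comp {f : Cn k → Cn k} {g : Cn k → ℂ} {y : Cn k} (hf : DifferentiableAt ℂ f y)
    (hg : DifferentiableAt ℝ g (f y)) :
    dbar (g ∘ f) y = (dbar g (f y)).compContinuousLinearMap (fderiv ℝ f y) := by
  ext v
  rw [ContinuousAlternatingMap.compContinuousLinearMap_apply, dbar_apply, dbar_apply,
    fderiv_comp y hg (hf.restrictScalars ℝ), hf.fderiv_restrictScalars ℝ]
  simp

theorem contDiffAt_dbar {g : Cn k → ℂ} {y : Cn k} (hg : ContDiffAt ℝ ∞ g y) :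
    ContDiffAt ℝ ∞ (dbar g) y := by
  have h := hg.fderiv_right (m := ∞) (by simp)
  exact (ContinuousAlternatingMap.ofSubsingletonLIE (𝕜 := ℝ) (E := Cn k) (F := ℂ)
    (0 : Fin 1)).contDiff.contDiffAt.comp y
      ((h.add ((h.clm_comp contDiffAt_const).const_smul Complex.I)).const_smul (1 / 2 : ℂ))

theorem contDiffAt_iddbarLocal {g : Cn k → ℂ} {y : Cn k} (hg : ContDiffAt ℝ ∞ g y) :
    ContDiffAt ℝ ∞ (iddbarLocal g) y := by
  have h := (contDiffAt_dbar hg).fderiv_right (m := ∞) (by simp)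
  exact ((ContinuousAlternatingMap.alternatizeUncurryFinCLM ℝ (Cn k) ℂ
    (n := 1)).contDiff.contDiffAt.comp y h).const_smul Complex.I

theorem iddbarLocal_comp {f : Cn k → Cn k} {g : Cn k → ℂ} {y : Cn k} (hf : ContDiffAt ℂ ∞ f y)
    (hg : ContDiffAt ℝ ∞ g (f y)) :
    iddbarLocal (g ∘ f) y = (iddbarLocal g (f y)).compContinuousLinearMap (fderiv ℝ f y) := by
  have hf2 : ∀ᶠ z in 𝓝 y, DifferentiableAt ℂ f z :=
    ((hf.of_le (m := 1) (by simp)).eventually (by simp)).mono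
      fun z hz => hz.differentiableAt (by simp)
  have hg2 : ∀ᶠ z in 𝓝 y, DifferentiableAt ℝ g (f z) :=
    hf.continuousAt.eventually (((hg.of_le (m := 1) (by simp)).eventually (by simp)).mono
      fun z hz => hz.differentiableAt (by simp))
  have h : dbar (g ∘ f) =ᶠ[𝓝 y]
      fun z => (dbar g (f z)).compContinuousLinearMap (fderiv ℝ f z) := by
    filter_upwards [hf2, hg2] with z h1 h2 using dbar_comp h1 h2
  have h2 := extDeriv_pullback ((contDiffAt_dbar hg).differentiableAt (by simp))
    (hf.restrict_scalars ℝ) (by simpa using two_le_infty)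
  rw [iddbarLocal, h.extDeriv_eq, h2]
  rfl

theorem iddbarLocal_congr {g g' : Cn k → ℂ} {y : Cn k} (h : g =ᶠ[𝓝 y] g') :
    iddbarLocal g y = iddbarLocal g' y := by
  have h2 : dbar g =ᶠ[𝓝 y] dbar g' := by
    filter_upwards [h.fderiv (𝕜 := ℝ)] with z hz
    simp [dbar, hz]
  rw [iddbarLocal, iddbarLocal, h2.extDeriv_eq]

theorem iddbarLocal_apply {g : Cn k → ℂ} {y : Cn k} (hg : ContDiffAt ℝ ∞ g y)
    (v : Fin 2 → Cn k) :
    iddbarLocal g y v = 1 / 2 * (fderiv ℝ (fderiv ℝ g) y (v 1) (Complex.I • v 0) -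
      fderiv ℝ (fderiv ℝ g) y (v 0) (Complex.I • v 1)) := by
  have hsymm : IsSymmSndFDerivAt ℝ g y :=
    hg.isSymmSndFDerivAt (by simpa using two_le_infty)
  have hd : DifferentiableAt ℝ (fderiv ℝ g) y :=
    (hg.fderiv_right (m := ∞) (by simp)).differentiableAt (by simp)
  have key : ∀ (w : Fin 1 → Cn k) (u : Cn k), fderiv ℝ (fun x => dbar g x w) y u =
      1 / 2 * (fderiv ℝ (fderiv ℝ g) y u (w 0) +
        Complex.I * fderiv ℝ (fderiv ℝ g) y u (Complex.I • w 0)) := by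
    intro w u
    have h1 : ∀ a : Cn k, HasFDerivAt (fun x => fderiv ℝ g x a)
        ((fderiv ℝ (fderiv ℝ g) y).flip a) y := fun a => by
      simpa using hd.hasFDerivAt.clm_apply (hasFDerivAt_const a y)
    have h2 := ((h1 (w 0)).add ((h1 (Complex.I • w 0)).const_smul Complex.I)).const_smul (1 / 2 : ℂ)
    have h3 : (fun x => dbar g x w) = fun x => (1 / 2 : ℂ) • (fderiv ℝ g x (w 0) +
        Complex.I • fderiv ℝ g x (Complex.I • w 0)) := by
      funext x; rw [dbar_apply]; rfl
    rw [h3]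
    refine (congrArg (fun L => L u) h2.fderiv).trans ?_
    rfl
  rw [iddbarLocal, ContinuousAlternatingMap.smul_apply,
    extDeriv_apply ((contDiffAt_dbar hg).differentiableAt (by simp)), Fin.sum_univ_two, key, key]
  have e0 : Fin.removeNth 0 v 0 = v 1 := rfl
  have e1 : Fin.removeNth 1 v 0 = v 0 := rfl
  rw [e0, e1, hsymm.eq (v 0) (v 1)]
  simp only [Fin.val_zero, Fin.val_one, pow_zero, pow_one, smul_eq_mul, one_smul, neg_smul]
  linear_combination (1 / 2 * (fderiv ℝ (fderiv ℝ g) y (v 0) (Complex.I • v 1) -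
    fderiv ℝ (fderiv ℝ g) y (v 1) (Complex.I • v 0))) * Complex.I_mul_I

theorem isType_iddbarLocal {g : Cn k → ℂ} {y : Cn k} (hg : ContDiffAt ℝ ∞ g y) :
    IsType 1 1 (iddbarLocal g y) := by
  intro c v
  have hsymm : IsSymmSndFDerivAt ℝ g y :=
    hg.isSymmSndFDerivAt (by simpa using two_le_infty)
  rw [iddbarLocal_apply hg, iddbarLocal_apply hg]
  set B := fderiv ℝ (fderiv ℝ g) y
  have hs : ∀ w : Cn k, c • w = c.re • w + c.im • (Complex.I • w) := fun w => by
    conv_lhs => rw [← Complex.re_add_im c]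
    rw [add_smul, mul_smul, Complex.coe_smul, Complex.coe_smul]
  have hI : ∀ w : Cn k, Complex.I • (c • w) = c.re • (Complex.I • w) - c.im • w := fun w => by
    conv_lhs => rw [← Complex.re_add_im c]
    rw [smul_smul, mul_add, add_smul, mul_comm Complex.I, mul_smul, Complex.coe_smul,
      mul_left_comm, Complex.I_mul_I, mul_neg_one, neg_smul, Complex.coe_smul, sub_eq_add_neg]
  have hc : c * starRingEnd ℂ c = (c.re : ℂ) ^ 2 + (c.im : ℂ) ^ 2 := by
    rw [Complex.mul_conj, Complex.normSq_apply]; push_cast; ring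
  simp only [Pi.smul_apply, hI]
  simp only [hs (v 0), hs (v 1), map_add, map_sub, map_smul,
    add_apply, smul_apply, Complex.real_smul, pow_one, hc]
  rw [hsymm.eq (Complex.I • v 0) (v 1), hsymm.eq (Complex.I • v 1) (v 0),
    hsymm.eq (Complex.I • v 0) (Complex.I • v 1), hsymm.eq (v 0) (v 1)]
  ring

end Pointwise

section Manifold

variable (k : ℕ) (M : Type*) [TopologicalSpace M] [ChartedSpace (Cn k) M]

/-- A field of alternating forms on `M`.  The tangent space `TangentSpace _ x` is by definition the
model space `ℂ^k`, a tangent vector at `x` being read in the preferred chart `chartAt _ x`. -/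
abbrev FormField (n : ℕ) : Type _ := M → Alt k n

variable {k M} {n : ℕ}

/-- The differential at `y` of the inverse of a chart, as a map of (real) tangent spaces. -/
def chartSymmDeriv (φ : OpenPartialHomeomorph M (Cn k)) (y : Cn k) : Cn k →L[ℝ] Cn k :=
  mfderiv 𝓘(ℝ, Cn k) 𝓘(ℝ, Cn k) φ.symm y

/-- The expression of a form in the chart `φ`, that is, its pullback by `φ⁻¹`
(meaningful on `φ.target`). -/
def inChart (φ : OpenPartialHomeomorph M (Cn k)) (θ : FormField k M n) : Cn k → Alt k n :=
  fun y => (θ (φ.symm y)).compContinuousLinearMap (chartSymmDeriv φ y)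

theorem inChart_add (φ : OpenPartialHomeomorph M (Cn k)) (θ θ' : FormField k M n) :
    inChart φ (θ + θ') = inChart φ θ + inChart φ θ' := rfl

theorem inChart_smul (φ : OpenPartialHomeomorph M (Cn k)) (c : ℂ) (θ : FormField k M n) :
    inChart φ (c • θ) = c • inChart φ θ := rfl

theorem inChart_zero (φ : OpenPartialHomeomorph M (Cn k)) :
    inChart φ (0 : FormField k M n) = fun _ => 0 := rfl

variable (k M)

/-- The space of smooth complex `n`-forms of type `(p,q)` on `M` (with `n = p + q`). -/
def smoothForms (n p q : ℕ) : Submodule ℂ (FormField k M n) where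
  carrier := {θ | (∀ x, IsType p q (θ x)) ∧
    ∀ φ ∈ atlas (Cn k) M, ContDiffOn ℝ ∞ (inChart φ θ) φ.target}
  add_mem' := fun h h' => ⟨fun x => (h.1 x).add (h'.1 x), fun φ hφ => by
    rw [inChart_add]; exact (h.2 φ hφ).add (h'.2 φ hφ)⟩
  zero_mem' := ⟨fun x => IsType.zero p q, fun φ hφ => by
    rw [inChart_zero]; exact contDiffOn_const⟩
  smul_mem' := fun c _ h => ⟨fun x => (h.1 x).smul c, fun φ hφ => by
    rw [inChart_smul]; exact (h.2 φ hφ).const_smul c⟩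

/-- The space of continuous complex `n`-forms of type `(p,q)` on `M` (with `n = p + q`). -/
def contForms (n p q : ℕ) : Submodule ℂ (FormField k M n) where
  carrier := {θ | (∀ x, IsType p q (θ x)) ∧
    ∀ φ ∈ atlas (Cn k) M, ContinuousOn (inChart φ θ) φ.target}
  add_mem' := fun h h' => ⟨fun x => (h.1 x).add (h'.1 x), fun φ hφ => by
    rw [inChart_add]; exact (h.2 φ hφ).add (h'.2 φ hφ)⟩
  zero_mem' := ⟨fun x => IsType.zero p q, fun φ hφ => by
    rw [inChart_zero]; exact continuousOn_const⟩
  smul_mem' := fun c _ h => ⟨fun x => (h.1 x).smul c, fun φ hφ => by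
    rw [inChart_smul]; exact (h.2 φ hφ).const_smul c⟩

variable {k M}

theorem smoothForms_le_contForms (n p q : ℕ) : smoothForms k M n p q ≤ contForms k M n p q :=
  fun _ h => ⟨h.1, fun φ hφ => (h.2 φ hφ).continuousOn⟩

/-- A smooth form, regarded as a continuous form. -/
def toCont {n p q : ℕ} (θ : smoothForms k M n p q) : contForms k M n p q :=
  ⟨θ.1, smoothForms_le_contForms n p q θ.2⟩

/-- `θ` is supported in the compact set `φ⁻¹(K)` and all derivatives of order `≤ m` of its
expression in the chart `φ` are bounded by `B` on `K`. -/
def BoundedInChart (φ : OpenPartialHomeomorph M (Cn k)) (K : Set (Cn k)) (m : ℕ) (B : ℝ)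
    (θ : FormField k M n) : Prop :=
  0 ≤ B ∧ (∀ x, x ∉ φ.symm '' K → θ x = 0) ∧
    ∀ j ≤ m, ∀ y ∈ K, ‖iteratedFDeriv ℝ j (inChart φ θ) y‖ ≤ B

variable (k M)

/-- Currents of bidimension `(p,q)` (with `n = p + q`) on a compact manifold `M`: complex linear
functionals on the space of smooth `(p,q)`-forms, continuous in the sense of distributions, i.e.
in each chart `φ` and for each compact `K` in the image of `φ`, bounded by finitely many
derivatives on the forms supported in `φ⁻¹(K)`. -/
structure Current (n p q : ℕ) where
  toFun : smoothForms k M n p q →ₗ[ℂ] ℂ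
  continuous' : ∀ φ ∈ atlas (Cn k) M, ∀ K ⊆ φ.target, IsCompact K →
    ∃ (m : ℕ) (C : ℝ), ∀ (B : ℝ) (θ : smoothForms k M n p q),
      BoundedInChart φ K m B θ.1 → ‖toFun θ‖ ≤ C * B

variable {k M}

/-- `T'` is an extension of the current `T` to the continuous `(p,q)`-forms which is continuous for
uniform convergence, i.e. satisfies in each chart the estimates of order `0`.  It exists exactly
when `T` is of order `0`, and it is then unique since the smooth forms are dense. -/
def IsOrderZeroExtension {n p q : ℕ} (T : Current k M n p q)
    (T' : contForms k M n p q →ₗ[ℂ] ℂ) : Prop :=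
  (∀ θ : smoothForms k M n p q, T' (toCont θ) = T.toFun θ) ∧
  ∀ φ ∈ atlas (Cn k) M, ∀ K ⊆ φ.target, IsCompact K →
    ∃ C : ℝ, ∀ (B : ℝ) (θ : contForms k M n p q),
      BoundedInChart φ K 0 B θ.1 → ‖T' θ‖ ≤ C * B

/-- The wedge product of a continuous `(1,0)`-form and a continuous `(0,1)`-form. -/
def wedgeForm (α : contForms k M 1 1 0) (β : contForms k M 1 0 1) : contForms k M 2 1 1 :=
  ⟨fun x => wedge (α.1 x) (β.1 x), fun x => (α.2.1 x).wedge (β.2.1 x), fun φ hφ => by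
    have h : inChart φ (fun x => wedge (α.1 x) (β.1 x)) =
        fun y => wedge (inChart φ α.1 y) (inChart φ β.1 y) :=
      funext fun y => wedge_compContinuousLinearMap _ _ _
    rw [h]
    exact continuousOn_wedge (α.2.2 φ hφ) (β.2.2 φ hφ)⟩

/-- A `(1,1)`-form which is positive definite at each point, i.e. the fundamental form of a
Hermitian metric. -/
def IsHermitianForm (Ω : smoothForms k M 2 1 1) : Prop := ∀ x, IsPosDefAt (Ω.1 x)

namespace Current

/-- A current of bidimension `(1,1)` is positive if `⟨T, θ⟩ ≥ 0` for every smooth positive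
`(1,1)`-form `θ`. -/
def IsPositive (T : Current k M 2 1 1) : Prop :=
  ∀ θ : smoothForms k M 2 1 1, (∀ x, IsPositiveAt (θ.1 x)) →
    0 ≤ (T.toFun θ).re ∧ (T.toFun θ).im = 0

/-- `∫ T ∧ Ω`, the mass of a positive current `T` with respect to the Hermitian form `Ω`. -/
def mass (T : Current k M 2 1 1) (Ω : smoothForms k M 2 1 1) : ℂ := T.toFun Ω

/-- `T ∧ α = 0`, for a current `T` of order zero and a continuous `(1,0)`-form `α`: the current
`T ∧ α`, which maps a smooth `(0,1)`-form `β` to `⟨T, α ∧ β⟩`, vanishes.  As `α ∧ β` is only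
continuous, `⟨T, α ∧ β⟩` is the value of the continuous extension of `T`. -/
def WedgeEqZero (T : Current k M 2 1 1) (α : contForms k M 1 1 0) : Prop :=
  ∃ T' : contForms k M 2 1 1 →ₗ[ℂ] ℂ, IsOrderZeroExtension T T' ∧
    ∀ β : smoothForms k M 1 0 1, T' (wedgeForm α (toCont β)) = 0

end Current

end Manifold

section Ddbar

variable {k : ℕ} {M : Type*} [TopologicalSpace M] [ChartedSpace (Cn k) M]

/-- The form `i∂∂̄u`, computed at `x` in the preferred chart at `x`; by `inChart_iddbarField`
every chart gives the same result. -/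
def iddbarField (u : M → ℂ) : FormField k M 2 := fun x =>
  iddbarLocal (u ∘ (chartAt (Cn k) x).symm) (chartAt (Cn k) x x)

theorem contDiffOn_coordChange [IsManifold 𝓘(ℂ, Cn k) ω M] {e e' : OpenPartialHomeomorph M (Cn k)}
    (he : e ∈ atlas (Cn k) M) (he' : e' ∈ atlas (Cn k) M) :
    ContDiffOn ℂ ω (e' ∘ e.symm) (e.symm ≫ₕ e').source := by
  have h := (contDiffGroupoid ω 𝓘(ℂ, Cn k)).compatible he he'
  have h' := (mem_groupoid_of_pregroupoid.1 h).1
  simpa [contDiffPregroupoid] using h'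

/-- The real manifold underlying a complex manifold. -/
theorem isManifold_real [IsManifold 𝓘(ℂ, Cn k) ω M] : IsManifold 𝓘(ℝ, Cn k) ∞ M := by
  refine isManifold_of_contDiffOn _ _ _ fun e e' he he' => ?_
  have h := contDiffOn_coordChange he he'
  simpa using (h.of_le le_top).restrict_scalars ℝ

theorem contDiffAt_comp_symm [IsManifold 𝓘(ℂ, Cn k) ω M] {u : M → ℂ}
    (hu : ContMDiff 𝓘(ℝ, Cn k) 𝓘(ℝ, ℂ) ∞ u) {φ : OpenPartialHomeomorph M (Cn k)}
    (hφ : φ ∈ atlas (Cn k) M) {y : Cn k} (hy : y ∈ φ.target) :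
    ContDiffAt ℝ ∞ (u ∘ φ.symm) y := by
  have := isManifold_real (k := k) (M := M)
  have h := contMDiffOn_symm_of_mem_maximalAtlas (I := 𝓘(ℝ, Cn k)) (n := ∞)
    (IsManifold.subset_maximalAtlas hφ)
  exact (hu.contMDiffAt.comp y (h.contMDiffAt (φ.open_target.mem_nhds hy))).contDiffAt

theorem chartSymmDeriv_eq [IsManifold 𝓘(ℂ, Cn k) ω M] {φ : OpenPartialHomeomorph M (Cn k)}
    (hφ : φ ∈ atlas (Cn k) M) {y : Cn k} (hy : y ∈ φ.target) :
    chartSymmDeriv φ y = fderiv ℝ (chartAt (Cn k) (φ.symm y) ∘ φ.symm) y := by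
  have := isManifold_real (k := k) (M := M)
  have h := contMDiffOn_symm_of_mem_maximalAtlas (I := 𝓘(ℝ, Cn k)) (n := ∞)
    (IsManifold.subset_maximalAtlas hφ)
  have hm : MDifferentiableAt 𝓘(ℝ, Cn k) 𝓘(ℝ, Cn k) φ.symm y :=
    (h.contMDiffAt (φ.open_target.mem_nhds hy)).mdifferentiableAt (by simp)
  rw [chartSymmDeriv, hm.mfderiv]
  simp [writtenInExtChartAt, extChartAt, Function.comp_def, chartAt_self_eq]

theorem inChart_iddbarField [IsManifold 𝓘(ℂ, Cn k) ω M] {u : M → ℂ}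
    (hu : ContMDiff 𝓘(ℝ, Cn k) 𝓘(ℝ, ℂ) ∞ u) {φ : OpenPartialHomeomorph M (Cn k)}
    (hφ : φ ∈ atlas (Cn k) M) {y : Cn k} (hy : y ∈ φ.target) :
    inChart φ (iddbarField u) y = iddbarLocal (u ∘ φ.symm) y := by
  set x := φ.symm y with hx
  set ψ := chartAt (Cn k) x with hψ
  have hψx : x ∈ ψ.source := mem_chart_source _ x
  have hψa : ψ ∈ atlas (Cn k) M := chart_mem_atlas _ x
  have hys : y ∈ (φ.symm ≫ₕ ψ).source := by
    simp [hy, ← hx, hψx]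
  have hf : ContDiffAt ℂ ∞ (ψ ∘ φ.symm) y :=
    ((contDiffOn_coordChange hφ hψa).of_le le_top).contDiffAt
      ((φ.symm ≫ₕ ψ).open_source.mem_nhds hys)
  have hg : ContDiffAt ℝ ∞ (u ∘ ψ.symm) (ψ x) :=
    contDiffAt_comp_symm hu hψa (ψ.map_source hψx)
  have hd : chartSymmDeriv φ y = fderiv ℝ (ψ ∘ φ.symm) y := chartSymmDeriv_eq hφ hy
  have he : u ∘ φ.symm =ᶠ[𝓝 y] (u ∘ ψ.symm) ∘ (ψ ∘ φ.symm) := by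
    filter_upwards [(φ.symm ≫ₕ ψ).open_source.mem_nhds hys] with z hz
    simp only [OpenPartialHomeomorph.trans_source, mem_inter_iff, mem_preimage] at hz
    simp [ψ.left_inv hz.2]
  rw [iddbarLocal_congr he, iddbarLocal_comp hf hg, inChart, hd]
  rfl

/-- The smooth `(1,1)`-form `i∂∂̄u`, for a smooth complex function `u` on `M`. -/
def iddbar [IsManifold 𝓘(ℂ, Cn k) ω M] (u : M → ℂ)
    (hu : ContMDiff 𝓘(ℝ, Cn k) 𝓘(ℝ, ℂ) ∞ u) : smoothForms k M 2 1 1 :=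
  ⟨iddbarField u, fun x => isType_iddbarLocal
      (contDiffAt_comp_symm hu (chart_mem_atlas _ x) (mem_chart_target _ x)),
    fun φ hφ => by
      have h : ContDiffOn ℝ ∞ (iddbarLocal (u ∘ φ.symm)) φ.target := fun y hy =>
        (contDiffAt_iddbarLocal (contDiffAt_comp_symm hu hφ hy)).contDiffWithinAt
      exact h.congr fun y hy => inChart_iddbarField hu hφ hy⟩

/-- `i∂∂̄T = 0`, i.e. `⟨i∂∂̄T, u⟩ = ⟨T, i∂∂̄u⟩ = 0` for every smooth function `u`. -/
def Current.IsDdbarClosed [IsManifold 𝓘(ℂ, Cn k) ω M] (T : Current k M 2 1 1) : Prop :=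
  ∀ (u : M → ℂ) (hu : ContMDiff 𝓘(ℝ, Cn k) 𝓘(ℝ, ℂ) ∞ u), T.toFun (iddbar u hu) = 0

end Ddbar

end PfaffCurrents

end

/-!
The current is produced by duality, following Sullivan. A nonzero tangent vector `v` at `x`
annihilated by all the `α j` defines a Dirac current `θ ↦ θ_x(v, i v)`, which is positive and killed
by wedging with `α j`; such vectors exist at every point, since `k - 1` linear forms on `ℂ^k` have
a common zero (`exists_ne_zero_forall_apply_eq_zero`). The required `T` is a limit of positive
combinations of Dirac currents that annihilates all the forms `i∂∂̄u`. By Hahn-Banach it exists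
unless some `Re i∂∂̄u` is positive on all the distinguished vectors, and this is impossible on a
compact manifold: at a maximum of `Re u` the real part of `i∂∂̄u(v, i v)` is nonpositive for every
`v` (`exists_re_iddbarField_nonpos`).

No measures are needed: M. Riesz' extension theorem is applied directly on the space of continuous
`(1,1)`-forms, with the cone of the forms whose real part is nonnegative on the distinguished
vectors (`exists_functional_of_evaluations`). Its hypothesis, and the order-zero estimates for the
resulting functional, come from the comparison of arbitrary forms with `Ω` on compact subsets of
charts (`exists_norm_apply_le`). The functional on continuous forms is then its own order-zero
extension.
-/

namespace PfaffCurrents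

/-! ### Functionals dominated by a family of evaluations -/

section Functional

variable {E S : Type*} [AddCommGroup E] [Module ℂ E]

/-- Let `ℓ` be a family of complex functionals and `e` a vector on which they are real and positive,
such that every vector is dominated by a multiple of `e`. If no element of the subspace `D` has all
its values `ℓ s` of positive real part, there is a complex functional `T` vanishing on `D`, with
`T e = 1`, and nonnegative in its real part wherever all the `ℓ s` are. -/
theorem exists_functional_of_evaluations (ℓ : S → E →ₗ[ℂ] ℂ) (D : Submodule ℂ E) (e : E)
    (he : ∀ s, 0 < (ℓ s e).re) (he' : ∀ s, (ℓ s e).im = 0)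
    (hD : ∀ θ ∈ D, ∃ s, (ℓ s θ).re ≤ 0)
    (hdom : ∀ θ, ∃ C : ℝ, ∀ s, ‖ℓ s θ‖ ≤ C * (ℓ s e).re) :
    ∃ T : E →ₗ[ℂ] ℂ, (∀ θ ∈ D, T θ = 0) ∧ T e = 1 ∧
      ∀ θ, (∀ s, 0 ≤ (ℓ s θ).re) → 0 ≤ (T θ).re := by
  have hsmul : ∀ (c : ℝ) (θ : E) (s : S), (ℓ s (c • θ)).re = c * (ℓ s θ).re := fun c θ s => by
    rw [← Complex.coe_smul, map_smul, smul_eq_mul, Complex.re_ofReal_mul]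
  let P : PointedCone ℝ E :=
    { carrier := {θ | ∀ s, 0 ≤ (ℓ s θ).re}
      add_mem' := fun {a b} h h' s => by
        rw [map_add, Complex.add_re]
        exact add_nonneg (h s) (h' s)
      zero_mem' := fun s => by simp
      smul_mem' := fun c θ h s => by
        have := hsmul c θ s
        exact this.symm ▸ mul_nonneg c.2 (h s) }
  have key : ∀ θ ∈ D, ∀ c : ℝ, θ + c • e ∈ P → 0 ≤ c := by
    intro θ hθ c h
    obtain ⟨s, hs⟩ := hD θ hθ
    have h1 := h s
    rw [map_add, Complex.add_re, hsmul] at h1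
    exact nonneg_of_mul_nonneg_left (by linarith) (he s)
  have hmem : e ∉ D.restrictScalars ℝ := fun h => by
    obtain ⟨s, hs⟩ := hD e h
    exact absurd (he s) hs.not_gt
  let f : E →ₗ.[ℝ] ℝ := LinearPMap.supSpanSingleton ⟨D.restrictScalars ℝ, 0⟩ e 1 hmem
  obtain ⟨Λ, hΛ, hpos⟩ := riesz_extension P f
    (by
      rintro ⟨z, hz⟩ hzs
      obtain ⟨θ, hθ, w, hw, rfl⟩ := Submodule.mem_sup.1 hz
      obtain ⟨c, rfl⟩ := Submodule.mem_span_singleton.1 hw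
      have hf : f ⟨θ + c • e, hz⟩ = c := by
        refine (LinearPMap.supSpanSingleton_apply_mk _ _ _ hmem θ hθ c).trans ?_
        simp
      rw [hf]
      exact key θ hθ c hzs)
    (by
      intro θ
      obtain ⟨C, hC⟩ := hdom θ
      refine ⟨⟨C • e,
        Submodule.mem_sup_right (Submodule.mem_span_singleton.2 ⟨C, rfl⟩)⟩, fun s => ?_⟩
      rw [map_add, Complex.add_re, hsmul]
      linarith [hC s, (abs_le.1 (Complex.abs_re_le_norm (ℓ s θ))).1])
  have hΛD : ∀ θ ∈ D, Λ θ = 0 := fun θ hθ => (hΛ ⟨θ, Submodule.mem_sup_left hθ⟩).trans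
    ((LinearPMap.supSpanSingleton_apply_mk_of_mem _ _ hmem hθ).trans rfl)
  have hΛe : Λ e = 1 := (hΛ ⟨e,
    Submodule.mem_sup_right (Submodule.mem_span_singleton_self _)⟩).trans
      (LinearPMap.supSpanSingleton_apply_self _ _ hmem)
  have hΛI : Λ (Complex.I • e) = 0 := by
    have hre : ∀ s, (ℓ s (Complex.I • e)).re = 0 := fun s => by
      rw [map_smul, smul_eq_mul, Complex.I_mul_re, he' s, neg_zero]
    have h1 := hpos (Complex.I • e) fun s => (hre s).ge
    have h2 := hpos (-(Complex.I • e)) fun s => by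
      rw [map_neg, Complex.neg_re, hre s, neg_zero]
    rw [map_neg] at h2
    linarith
  let T : E →ₗ[ℂ] ℂ := Module.Dual.extendRCLike (𝕜 := ℂ) Λ
  have hTre : ∀ θ, (T θ).re = Λ θ := fun θ => Module.Dual.re_extendRCLike_apply (𝕜 := ℂ) Λ θ
  have hTim : ∀ θ, (T θ).im = -Λ (Complex.I • θ) := fun θ =>
    Module.Dual.im_extendRCLike_apply (𝕜 := ℂ) Λ θ
  refine ⟨T, fun θ hθ => Complex.ext ?_ ?_, Complex.ext ?_ ?_, fun θ hθ => ?_⟩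
  · rw [hTre, hΛD θ hθ, Complex.zero_re]
  · rw [hTim, hΛD _ (D.smul_mem _ hθ), neg_zero, Complex.zero_im]
  · rw [hTre, hΛe, Complex.one_re]
  · rw [hTim, hΛI, neg_zero, Complex.one_im]
  · rw [hTre]
    exact hpos θ hθ

variable {ℓ : S → E →ₗ[ℂ] ℂ} {T : E →ₗ[ℂ] ℂ}

theorem norm_apply_le_of_forall_norm_le (hT : ∀ θ, (∀ s, 0 ≤ (ℓ s θ).re) → 0 ≤ (T θ).re) {e : E}
    (hTe : T e = 1) {θ : E} {C : ℝ} (hθ : ∀ s, ‖ℓ s θ‖ ≤ C * (ℓ s e).re) : ‖T θ‖ ≤ C := by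
  -- After multiplying `θ` by a unit complex number `c`, the value `T θ` becomes `‖T θ‖`.
  obtain ⟨c, hc, hcT⟩ := RCLike.exists_norm_eq_mul_self (T θ)
  have h := hT ((C : ℂ) • e - c • θ) fun s => by
    have h1 : (c * ℓ s θ).re ≤ ‖ℓ s θ‖ := by
      simpa [hc] using Complex.re_le_norm (c * ℓ s θ)
    rw [map_sub, map_smul, map_smul, smul_eq_mul, smul_eq_mul, Complex.sub_re,
      Complex.re_ofReal_mul]
    linarith [hθ s]
  rw [map_sub, map_smul, map_smul, hTe, smul_eq_mul, smul_eq_mul, ← hcT, mul_one,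
    Complex.sub_re] at h
  have h2 : ‖T θ‖ ≤ C := by simpa using h
  exact h2

theorem im_apply_eq_zero (hT : ∀ θ, (∀ s, 0 ≤ (ℓ s θ).re) → 0 ≤ (T θ).re) {θ : E}
    (hθ : ∀ s, (ℓ s θ).im = 0) : (T θ).im = 0 := by
  have h1 := hT (Complex.I • θ) fun s => by simp [hθ s]
  have h2 := hT (-(Complex.I • θ)) fun s => by simp [hθ s]
  simp only [map_neg, map_smul, smul_eq_mul, Complex.neg_re, Complex.I_mul_re] at h1 h2
  linarith

end Functional

/-! ### Forms on `ℂ^k` and the second derivative at a maximum -/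

section Pointwise

variable {k : ℕ}

theorem apply_zero_smul_I (a : Alt k 2) :
    a ![(0 : Cn k), Complex.I • (0 : Cn k)] = 0 :=
  a.map_coord_zero (m := ![0, Complex.I • 0]) 0 rfl

theorem IsPosDefAt.nonneg {a : Alt k 2} (ha : IsPosDefAt a) (v : Cn k) :
    0 ≤ (a ![v, Complex.I • v]).re := by
  rcases eq_or_ne v 0 with rfl | hv
  · rw [apply_zero_smul_I, Complex.zero_re]
  · exact (ha v hv).1.le

theorem norm_apply_smul_I_le (a : Alt k 2) (v : Cn k) :
    ‖a ![v, Complex.I • v]‖ ≤ ‖a‖ * ‖v‖ ^ 2 := by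
  refine (a.le_opNorm _).trans_eq ?_
  simp [Fin.prod_univ_two, norm_smul, sq]

theorem compContinuousLinearMap_apply_smul_I (a : Alt k 2) (L : Cn k →L[ℝ] Cn k)
    (hL : ∀ v, L (Complex.I • v) = Complex.I • L v) (v : Cn k) :
    a.compContinuousLinearMap L ![v, Complex.I • v] = a ![L v, Complex.I • L v] := by
  rw [ContinuousAlternatingMap.compContinuousLinearMap_apply]
  congr 1
  funext i
  fin_cases i
  · rfl
  · exact hL v

theorem continuous_apply_smul_I :
    Continuous fun p : Alt k 2 × Cn k => (p.1 ![p.2, Complex.I • p.2]).re := by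
  refine Complex.continuous_re.comp ?_
  refine ContinuousEval.continuous_eval.comp (continuous_fst.prodMk ?_)
  refine continuous_pi fun i => ?_
  fin_cases i
  · exact continuous_snd
  · exact continuous_snd.const_smul Complex.I

theorem iddbarLocal_add {g g' : Cn k → ℂ} {y : Cn k} (hg : ContDiffAt ℝ ∞ g y)
    (hg' : ContDiffAt ℝ ∞ g' y) :
    iddbarLocal (g + g') y = iddbarLocal g y + iddbarLocal g' y := by
  have hd : ∀ {f : Cn k → ℂ}, ContDiffAt ℝ ∞ f y → ∀ᶠ z in 𝓝 y, DifferentiableAt ℝ f z :=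
    fun hf => ((hf.of_le (m := 1) (by simp)).eventually (by simp)).mono
      fun z hz => hz.differentiableAt (by simp)
  have h : dbar (g + g') =ᶠ[𝓝 y] dbar g + dbar g' := by
    filter_upwards [hd hg, hd hg'] with z h1 h2
    ext v
    rw [Pi.add_apply, ContinuousAlternatingMap.add_apply, dbar_apply, dbar_apply, dbar_apply,
      fderiv_add h1 h2]
    simp only [add_apply]
    ring
  rw [iddbarLocal, h.extDeriv_eq, extDeriv_add
    ((contDiffAt_dbar hg).differentiableAt (by simp))
    ((contDiffAt_dbar hg').differentiableAt (by simp)), smul_add]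
  rfl

theorem iddbarLocal_const_smul (c : ℂ) {g : Cn k → ℂ} {y : Cn k} (hg : ContDiffAt ℝ ∞ g y) :
    iddbarLocal (c • g) y = c • iddbarLocal g y := by
  have hcg : ContDiffAt ℝ ∞ (c • g) y := contDiffAt_const.smul hg
  have h2 : fderiv ℝ (fderiv ℝ (c • g)) y = c • fderiv ℝ (fderiv ℝ g) y := by
    rw [fderiv_const_smul_field]
    exact congrFun (fderiv_const_smul_field (𝕜 := ℝ) (f := fderiv ℝ g) c) y
  ext v
  rw [ContinuousAlternatingMap.smul_apply, iddbarLocal_apply hcg, iddbarLocal_apply hg, h2]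
  simp only [smul_apply, smul_eq_mul]
  ring

/-- At a local maximum of the real part of `g`, the second derivative of `Re g` in every direction
is nonpositive: otherwise the second derivative test would also give a local minimum, `Re g` would
be constant along the line, and its second derivative would vanish. -/
theorem re_fderiv_fderiv_nonpos {g : Cn k → ℂ} {y : Cn k} (hg : ContDiffAt ℝ ∞ g y)
    (hmax : IsLocalMax (fun z => (g z).re) y) (v : Cn k) :
    (fderiv ℝ (fderiv ℝ g) y v v).re ≤ 0 := by
  set l : ℝ → Cn k := fun t => y + t • v with hl
  have hl0 : l 0 = y := by simp [hl]
  have hld : ∀ t, HasDerivAt l v t := fun t =>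
    (((hasDerivAt_id t).smul_const v).const_add y).congr_deriv (one_smul ℝ v)
  have hlc : Tendsto l (𝓝 0) (𝓝 y) := by
    simpa only [hl0] using (hld 0).continuousAt.tendsto
  have hd : ∀ᶠ z in 𝓝 y, DifferentiableAt ℝ g z :=
    ((hg.of_le (m := 1) (by simp)).eventually (by simp)).mono
      fun z hz => hz.differentiableAt (by simp)
  set h : ℝ → ℝ := fun t => (g (l t)).re with hh
  have h1 : ∀ᶠ t in 𝓝 (0 : ℝ), HasDerivAt h (fderiv ℝ g (l t) v).re t := by
    filter_upwards [hlc.eventually hd] with t ht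
    exact Complex.reCLM.hasFDerivAt.comp_hasDerivAt t (ht.hasFDerivAt.comp_hasDerivAt t (hld t))
  have h1' : deriv h =ᶠ[𝓝 0] fun t => (fderiv ℝ g (l t) v).re := h1.mono fun t ht => ht.deriv
  have hd2 : HasFDerivAt (fderiv ℝ g) (fderiv ℝ (fderiv ℝ g) y) (l 0) := by
    rw [hl0]
    exact ((hg.fderiv_right (m := ∞) (by simp)).differentiableAt (by simp)).hasFDerivAt
  have h2 : HasDerivAt (fun t => (fderiv ℝ g (l t) v).re) (fderiv ℝ (fderiv ℝ g) y v v).re 0 := by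
    have := (hd2.comp_hasDerivAt (0 : ℝ) (hld 0)).clm_apply (hasDerivAt_const (0 : ℝ) v)
    refine (Complex.reCLM.hasFDerivAt.comp_hasDerivAt (0 : ℝ) this).congr_deriv ?_
    simp
  have h2' : deriv (deriv h) 0 = (fderiv ℝ (fderiv ℝ g) y v v).re := by
    rw [h1'.deriv_eq, h2.deriv]
  have hm : IsLocalMax h 0 := by
    have := hlc.eventually hmax
    simpa only [IsLocalMax, IsMaxFilter, hh, hl0] using this
  by_contra! hpos
  have hmin : IsLocalMin h 0 := isLocalMin_of_deriv_deriv_pos (by rw [h2']; exact hpos)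
    hm.deriv_eq_zero h1.self_of_nhds.continuousAt
  have hc : h =ᶠ[𝓝 0] fun _ => h 0 := by
    filter_upwards [hm, hmin] with t ht ht' using le_antisymm ht ht'
  have hc' : deriv h =ᶠ[𝓝 0] fun _ => 0 := by
    filter_upwards [hc.eventuallyEq_nhds] with t ht
    rw [ht.deriv_eq, deriv_const]
  rw [← h2', hc'.deriv_eq, deriv_const] at hpos
  exact lt_irrefl _ hpos

theorem re_iddbarLocal_nonpos {g : Cn k → ℂ} {y : Cn k} (hg : ContDiffAt ℝ ∞ g y)
    (hmax : IsLocalMax (fun z => (g z).re) y) (v : Cn k) :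
    (iddbarLocal g y ![v, Complex.I • v]).re ≤ 0 := by
  have h1 := re_fderiv_fderiv_nonpos hg hmax v
  have h2 := re_fderiv_fderiv_nonpos hg hmax (Complex.I • v)
  have hI : Complex.I • Complex.I • v = -v := by rw [smul_smul, Complex.I_mul_I, neg_one_smul]
  have e : iddbarLocal g y ![v, Complex.I • v] = ((1 / 2 : ℝ) : ℂ) *
      (fderiv ℝ (fderiv ℝ g) y (Complex.I • v) (Complex.I • v) +
        fderiv ℝ (fderiv ℝ g) y v v) := by
    rw [iddbarLocal_apply hg]
    simp [hI]
  rw [e, Complex.re_ofReal_mul, Complex.add_re]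
  linarith

/-- Fewer than `k` forms of type `(1,0)` on `ℂ^k`, being `ℂ`-linear, have a common zero. -/
theorem exists_ne_zero_forall_apply_eq_zero {m : ℕ} (hm : m < k) (a : Fin m → Alt k 1)
    (ha : ∀ j, IsType 1 0 (a j)) : ∃ v : Cn k, v ≠ 0 ∧ ∀ j, a j (fun _ => v) = 0 := by
  let f : Cn k →ₗ[ℂ] (Fin m → ℂ) :=
    { toFun := fun v j => a j fun _ => v
      map_add' := fun v w => by
        funext j
        exact ((ContinuousAlternatingMap.ofSubsingleton ℝ (Cn k) ℂ (0 : Fin 1)).symm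
          (a j)).map_add v w
      map_smul' := fun c v => by
        funext j
        simpa [Pi.smul_def] using ha j c (fun _ => v) }
  obtain ⟨v, hv, hv0⟩ := (Submodule.ne_bot_iff _).1
    (LinearMap.ker_ne_bot_of_finrank_lt (f := f) (by simpa using hm))
  exact ⟨v, hv0, fun j => congrFun (LinearMap.mem_ker.1 hv) j⟩

/-- `a ∧ b` vanishes on the complex line spanned by a zero of the `(1,0)`-form `a`. -/
theorem wedge_apply_smul_I_eq_zero {a b : Alt k 1} (ha : IsType 1 0 a) {v : Cn k}
    (hv : a (fun _ => v) = 0) : wedge a b ![v, Complex.I • v] = 0 := by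
  have h : a (fun _ => Complex.I • v) = 0 := by
    simpa [Pi.smul_def, hv] using ha Complex.I (fun _ => v)
  simp [wedge_apply, hv, h]

end Pointwise

/-! ### Domination by a Hermitian form and the maximum principle on `M` -/

section Manifold

variable {k : ℕ} {M : Type*} [TopologicalSpace M] [ChartedSpace (Cn k) M]
  [IsManifold 𝓘(ℂ, Cn k) ω M]

theorem differentiableAt_coordChange {φ ψ : OpenPartialHomeomorph M (Cn k)}
    (hφ : φ ∈ atlas (Cn k) M) (hψ : ψ ∈ atlas (Cn k) M) {y : Cn k}
    (hy : y ∈ (φ.symm ≫ₕ ψ).source) : DifferentiableAt ℂ (ψ ∘ φ.symm) y :=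
  (((contDiffOn_coordChange hφ hψ).of_le le_top).contDiffAt (n := ∞)
    ((φ.symm ≫ₕ ψ).open_source.mem_nhds hy)).differentiableAt (by simp)

theorem chartSymmDeriv_smul_I {φ : OpenPartialHomeomorph M (Cn k)} (hφ : φ ∈ atlas (Cn k) M)
    {y : Cn k} (hy : y ∈ φ.target) (v : Cn k) :
    chartSymmDeriv φ y (Complex.I • v) = Complex.I • chartSymmDeriv φ y v := by
  have hd := differentiableAt_coordChange hφ (chart_mem_atlas (Cn k) (φ.symm y))
    (show y ∈ (φ.symm ≫ₕ chartAt (Cn k) (φ.symm y)).source by simp [hy])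
  rw [chartSymmDeriv_eq hφ hy, hd.fderiv_restrictScalars ℝ]
  simp

theorem chartSymmDeriv_surjective {φ : OpenPartialHomeomorph M (Cn k)} (hφ : φ ∈ atlas (Cn k) M)
    {y : Cn k} (hy : y ∈ φ.target) : Function.Surjective (chartSymmDeriv φ y) := by
  set ψ := chartAt (Cn k) (φ.symm y) with hψ
  have hψa : ψ ∈ atlas (Cn k) M := chart_mem_atlas _ _
  have hs : φ.symm y ∈ ψ.source := mem_chart_source _ _
  have hz : ψ (φ.symm y) ∈ (ψ.symm ≫ₕ φ).source := by
    simp [ψ.map_source hs, ψ.left_inv hs, φ.map_target hy]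
  have hgz : (φ ∘ ψ.symm) (ψ (φ.symm y)) = y := by
    simp [ψ.left_inv hs, φ.right_inv hy]
  have hf : DifferentiableAt ℝ (ψ ∘ φ.symm) ((φ ∘ ψ.symm) (ψ (φ.symm y))) := by
    rw [hgz]
    exact (differentiableAt_coordChange hφ hψa (by simp [hy, hs])).restrictScalars ℝ
  have hg := (differentiableAt_coordChange hψa hφ hz).restrictScalars ℝ
  have hid : (ψ ∘ φ.symm) ∘ (φ ∘ ψ.symm) =ᶠ[𝓝 (ψ (φ.symm y))] id := by
    filter_upwards [(ψ.symm ≫ₕ φ).open_source.mem_nhds hz] with w hw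
    simp only [OpenPartialHomeomorph.trans_source, mem_inter_iff, mem_preimage,
      OpenPartialHomeomorph.symm_source] at hw
    simp [φ.left_inv hw.2, ψ.right_inv hw.1]
  have h := fderiv_comp _ hf hg
  rw [hid.fderiv_eq, fderiv_id, hgz] at h
  intro v
  refine ⟨fderiv ℝ (φ ∘ ψ.symm) (ψ (φ.symm y)) v, ?_⟩
  rw [chartSymmDeriv_eq hφ hy]
  exact (congrArg (fun L => L v) h).symm

theorem chartSymmDeriv_injective {φ : OpenPartialHomeomorph M (Cn k)} (hφ : φ ∈ atlas (Cn k) M)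
    {y : Cn k} (hy : y ∈ φ.target) : Function.Injective (chartSymmDeriv φ y) :=
  (LinearMap.injective_iff_surjective (f := (chartSymmDeriv φ y).toLinearMap)).2
    (chartSymmDeriv_surjective hφ hy)

/-- On a compact subset of a chart, the Hermitian form `Ω` dominates every `2`-form, up to a
constant times the norm of that form in the chart. -/
theorem exists_norm_apply_le (Ω : smoothForms k M 2 1 1) (hΩ : IsHermitianForm Ω)
    {φ : OpenPartialHomeomorph M (Cn k)} (hφ : φ ∈ atlas (Cn k) M) {K : Set (Cn k)}
    (hK : K ⊆ φ.target) (hKc : IsCompact K) :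
    ∃ C : ℝ, 0 ≤ C ∧ ∀ (θ : FormField k M 2), ∀ y ∈ K, ∀ v : Cn k,
      ‖θ (φ.symm y) ![v, Complex.I • v]‖ ≤
        C * ‖inChart φ θ y‖ * (Ω.1 (φ.symm y) ![v, Complex.I • v]).re := by
  have hin : ∀ (θ : FormField k M 2), ∀ y ∈ K, ∀ w : Cn k,
      inChart φ θ y ![w, Complex.I • w] =
        θ (φ.symm y) ![chartSymmDeriv φ y w, Complex.I • chartSymmDeriv φ y w] :=
    fun θ y hy w => compContinuousLinearMap_apply_smul_I _ _ (chartSymmDeriv_smul_I hφ (hK hy)) w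
  -- The values of `Ω` on the unit vectors over `K` have a positive lower bound `c`.
  obtain ⟨c, hc, hcle⟩ : ∃ c : ℝ, 0 < c ∧ ∀ p ∈ K ×ˢ Metric.sphere (0 : Cn k) 1,
      c ≤ (inChart φ Ω.1 p.1 ![p.2, Complex.I • p.2]).re := by
    refine (hKc.prod (isCompact_sphere _ _)).exists_forall_le' ?_ ?_
    · exact continuous_apply_smul_I.comp_continuousOn
        (f := fun p : Cn k × Cn k => (inChart φ Ω.1 p.1, p.2))
        ((((Ω.2.2 φ hφ).continuousOn.mono hK).comp continuousOn_fst
          fun p hp => hp.1).prodMk continuousOn_snd)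
    · rintro ⟨y, w⟩ ⟨hy, hw⟩
      rw [hin Ω.1 y hy w]
      refine (hΩ _ _ fun h0 => ?_).1
      have : w = 0 := chartSymmDeriv_injective hφ (hK hy) (by simpa using h0)
      simp [this] at hw
  have hquad : ∀ y ∈ K, ∀ w : Cn k,
      c * ‖w‖ ^ 2 ≤ (inChart φ Ω.1 y ![w, Complex.I • w]).re := by
    intro y hy w
    rcases eq_or_ne w 0 with rfl | hw
    · simp only [apply_zero_smul_I, norm_zero, Complex.zero_re]
      norm_num
    have hn : ‖w‖ ≠ 0 := norm_ne_zero_iff.2 hw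
    have h1 := hcle (y, ‖w‖⁻¹ • w) ⟨hy, by simp [norm_smul, hn]⟩
    have h2 : (![‖w‖⁻¹ • w, Complex.I • ‖w‖⁻¹ • w] : Fin 2 → Cn k) =
        fun i => (fun _ : Fin 2 => ‖w‖⁻¹) i • ![w, Complex.I • w] i := by
      funext i
      fin_cases i
      · rfl
      · exact smul_comm _ _ _
    simp only at h1
    rw [h2, (inChart φ Ω.1 y).map_smul_univ] at h1
    simp only [Finset.prod_const, Finset.card_univ, Fintype.card_fin, Complex.smul_re,
      smul_eq_mul] at h1
    calc c * ‖w‖ ^ 2 ≤ (‖w‖⁻¹ ^ 2 * (inChart φ Ω.1 y ![w, Complex.I • w]).re) * ‖w‖ ^ 2 := by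
          gcongr
      _ = _ := by field_simp
  refine ⟨c⁻¹, (inv_pos.2 hc).le, fun θ y hy v => ?_⟩
  obtain ⟨w, rfl⟩ := chartSymmDeriv_surjective hφ (hK hy) v
  rw [← hin θ y hy, ← hin Ω.1 y hy]
  refine (norm_apply_smul_I_le _ w).trans ?_
  have := hquad y hy w
  calc ‖inChart φ θ y‖ * ‖w‖ ^ 2 = c⁻¹ * ‖inChart φ θ y‖ * (c * ‖w‖ ^ 2) := by field_simp
    _ ≤ _ := by gcongr

/-- Every continuous `(1,1)`-form on a compact manifold is dominated by a multiple of `Ω`. -/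
theorem exists_forall_norm_apply_le [CompactSpace M] (Ω : smoothForms k M 2 1 1)
    (hΩ : IsHermitianForm Ω) (θ : contForms k M 2 1 1) :
    ∃ C : ℝ, ∀ (x : M) (v : Cn k),
      ‖θ.1 x ![v, Complex.I • v]‖ ≤ C * (Ω.1 x ![v, Complex.I • v]).re := by
  suffices h : ∃ C : ℝ, ∀ x ∈ (univ : Set M), ∀ v : Cn k,
      ‖θ.1 x ![v, Complex.I • v]‖ ≤ C * (Ω.1 x ![v, Complex.I • v]).re by simpa using h
  refine isCompact_univ.induction_on (p := fun s => ∃ C : ℝ, ∀ x ∈ s, ∀ v : Cn k,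
      ‖θ.1 x ![v, Complex.I • v]‖ ≤ C * (Ω.1 x ![v, Complex.I • v]).re) ⟨0, by simp⟩
    (fun s t hst ⟨C, hC⟩ => ⟨C, fun x hx => hC x (hst hx)⟩) ?_ ?_
  · rintro s t ⟨C, hC⟩ ⟨D, hD⟩
    refine ⟨max C D, fun x hx v => ?_⟩
    have h0 := (hΩ x).nonneg v
    rcases hx with hx | hx
    · exact (hC x hx v).trans (mul_le_mul_of_nonneg_right (le_max_left _ _) h0)
    · exact (hD x hx v).trans (mul_le_mul_of_nonneg_right (le_max_right _ _) h0)
  · intro x _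
    set φ := chartAt (Cn k) x
    have hφ : φ ∈ atlas (Cn k) M := chart_mem_atlas _ _
    have hx : x ∈ φ.source := mem_chart_source _ _
    obtain ⟨K, hKn, hK, hKc⟩ := local_compact_nhds (φ.open_target.mem_nhds (φ.map_source hx))
    obtain ⟨C, hC0, hC⟩ := exists_norm_apply_le Ω hΩ hφ hK hKc
    obtain ⟨B, hB⟩ := hKc.exists_bound_of_continuousOn ((θ.2.2 φ hφ).mono hK)
    refine ⟨φ.source ∩ φ ⁻¹' K, mem_nhdsWithin_of_mem_nhds
      (inter_mem (φ.open_source.mem_nhds hx) ((φ.continuousAt hx).preimage_mem_nhds hKn)),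
      C * B, fun z hz v => ?_⟩
    have h := hC θ.1 (φ z) hz.2 v
    rw [φ.left_inv hz.1] at h
    refine h.trans ?_
    have h0 := (hΩ z).nonneg v
    have := hB (φ z) hz.2
    gcongr

/-- The maximum principle: `i∂∂̄u` is nonpositive, in its real part, at some point of a compact
manifold, namely at a maximum of `Re u`. -/
theorem exists_re_iddbarField_nonpos [CompactSpace M] [Nonempty M] {u : M → ℂ}
    (hu : ContMDiff 𝓘(ℝ, Cn k) 𝓘(ℝ, ℂ) ∞ u) :
    ∃ x : M, ∀ v : Cn k, (iddbarField u x ![v, Complex.I • v]).re ≤ 0 := by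
  obtain ⟨x, -, hx⟩ := isCompact_univ.exists_isMaxOn (univ_nonempty (α := M))
    (Complex.continuous_re.comp hu.continuous).continuousOn
  refine ⟨x, re_iddbarLocal_nonpos
    (contDiffAt_comp_symm hu (chart_mem_atlas _ x) (mem_chart_target _ x)) ?_⟩
  refine Eventually.of_forall fun z => ?_
  simpa [(chartAt (Cn k) x).left_inv (mem_chart_source _ x)] using
    hx (mem_univ ((chartAt (Cn k) x).symm z))

variable (k M) in
/-- The space of the continuous forms `i∂∂̄u`, for smooth complex functions `u`. -/
def ddbarExact : Submodule ℂ (contForms k M 2 1 1) where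
  carrier := {θ | ∃ (u : M → ℂ) (hu : ContMDiff 𝓘(ℝ, Cn k) 𝓘(ℝ, ℂ) ∞ u), θ = toCont (iddbar u hu)}
  add_mem' := by
    rintro _ _ ⟨u, hu, rfl⟩ ⟨u', hu', rfl⟩
    refine ⟨u + u', hu.add hu', Subtype.ext (funext fun x => ?_)⟩
    exact (iddbarLocal_add
      (contDiffAt_comp_symm hu (chart_mem_atlas _ x) (mem_chart_target _ x))
      (contDiffAt_comp_symm hu' (chart_mem_atlas _ x) (mem_chart_target _ x))).symm
  zero_mem' := by
    refine ⟨fun _ => 0, contMDiff_const, Subtype.ext (funext fun x => ?_)⟩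
    have h : iddbarLocal (fun _ : Cn k => (0 : ℂ)) (chartAt (Cn k) x x) = 0 := by
      ext v
      rw [iddbarLocal_apply contDiffAt_const]
      simp
    exact h.symm
  smul_mem' := by
    rintro c _ ⟨u, hu, rfl⟩
    refine ⟨c • u, (contDiff_const_smul c).contMDiff.comp hu, Subtype.ext (funext fun x => ?_)⟩
    exact (iddbarLocal_const_smul c
      (contDiffAt_comp_symm hu (chart_mem_atlas _ x) (mem_chart_target _ x))).symm

/-! ### Dirac currents on the common kernel and the theorem -/

variable (k M) in
/-- The Dirac functional `θ ↦ θ_x(v, i v)` on the continuous `(1,1)`-forms. -/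
noncomputable def diracForm (x : M) (v : Cn k) : contForms k M 2 1 1 →ₗ[ℂ] ℂ where
  toFun θ := θ.1 x ![v, Complex.I • v]
  map_add' _ _ := rfl
  map_smul' _ _ := rfl

/-- A functional `T` on the continuous `(1,1)`-forms which vanishes on the forms `i∂∂̄u`, satisfies
`T Ω = 1`, is positive, and is bounded by the size, relative to `Ω`, of `θ(v, i v)` for `v` in the
common kernel of the `α j`. -/
theorem exists_functional [CompactSpace M] [Nonempty M] (Ω : smoothForms k M 2 1 1)
    (hΩ : IsHermitianForm Ω) {m : ℕ} (hm : m < k) (α : Fin m → contForms k M 1 1 0) :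
    ∃ T : contForms k M 2 1 1 →ₗ[ℂ] ℂ, (∀ θ ∈ ddbarExact k M, T θ = 0) ∧ T (toCont Ω) = 1 ∧
      (∀ θ : contForms k M 2 1 1, (∀ x, IsPositiveAt (θ.1 x)) → 0 ≤ (T θ).re ∧ (T θ).im = 0) ∧
      ∀ (θ : contForms k M 2 1 1) (C : ℝ),
        (∀ (x : M) (v : Cn k), (∀ j, (α j).1 x (fun _ => v) = 0) →
          ‖θ.1 x ![v, Complex.I • v]‖ ≤ C * (Ω.1 x ![v, Complex.I • v]).re) → ‖T θ‖ ≤ C := by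
  let S := {p : M × Cn k // p.2 ≠ 0 ∧ ∀ j, (α j).1 p.1 (fun _ => p.2) = 0}
  let ℓ : S → contForms k M 2 1 1 →ₗ[ℂ] ℂ := fun s => diracForm k M s.1.1 s.1.2
  have hD : ∀ θ ∈ ddbarExact k M, ∃ s, (ℓ s θ).re ≤ 0 := by
    rintro _ ⟨u, hu, rfl⟩
    obtain ⟨x, hx⟩ := exists_re_iddbarField_nonpos hu
    obtain ⟨v, hv0, hv⟩ := exists_ne_zero_forall_apply_eq_zero hm (fun j => (α j).1 x)
      fun j => (α j).2.1 x
    exact ⟨⟨(x, v), hv0, hv⟩, hx v⟩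
  have hdom : ∀ θ, ∃ C : ℝ, ∀ s, ‖ℓ s θ‖ ≤ C * (ℓ s (toCont Ω)).re := fun θ => by
    obtain ⟨C, hC⟩ := exists_forall_norm_apply_le Ω hΩ θ
    exact ⟨C, fun s => hC _ _⟩
  obtain ⟨T, hTD, hTΩ, hT⟩ := exists_functional_of_evaluations ℓ (ddbarExact k M) (toCont Ω)
    (fun s => (hΩ s.1.1 s.1.2 s.2.1).1) (fun s => (hΩ s.1.1 s.1.2 s.2.1).2) hD hdom
  exact ⟨T, hTD, hTΩ,
    fun θ hθ => ⟨hT θ fun s => (hθ s.1.1 s.1.2).1,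
      im_apply_eq_zero hT (θ := θ) fun s => (hθ s.1.1 s.1.2).2⟩,
    fun θ C hθ => norm_apply_le_of_forall_norm_le hT hTΩ (θ := θ) (C := C)
      fun s => hθ s.1.1 s.1.2 s.2.2⟩

end Manifold

end PfaffCurrents

open PfaffCurrents in
theorem theorem1p1 (k : ℕ) (hk : 1 ≤ k) (M : Type*) [TopologicalSpace M] [T2Space M]
    [CompactSpace M] [Nonempty M] [ChartedSpace (Cn k) M] [IsManifold 𝓘(ℂ, Cn k) ω M]
    (Ω : smoothForms k M 2 1 1) (hΩ : IsHermitianForm Ω)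
    (α : Fin (k - 1) → contForms k M 1 1 0) :
    ∃ T : Current k M 2 1 1, T.IsPositive ∧ T.mass Ω = 1 ∧ (∀ j, T.WedgeEqZero (α j)) ∧
      T.IsDdbarClosed := by
  obtain ⟨T', hexact, hmass, hpos, hle⟩ := exists_functional Ω hΩ (by omega : k - 1 < k) α
  have hbound : ∀ φ ∈ atlas (Cn k) M, ∀ K ⊆ φ.target, IsCompact K →
      ∃ C : ℝ, ∀ (B : ℝ) (θ : contForms k M 2 1 1),
        BoundedInChart φ K 0 B θ.1 → ‖T' θ‖ ≤ C * B := by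
    intro φ hφ K hK hKc
    obtain ⟨C, hC0, hC⟩ := exists_norm_apply_le Ω hΩ hφ hK hKc
    refine ⟨C, fun B θ ⟨hB0, hsupp, hB⟩ => hle θ (C * B) fun x v _ => ?_⟩
    have h0 := (hΩ x).nonneg v
    by_cases hx : x ∈ φ.symm '' K
    · obtain ⟨y, hy, rfl⟩ := hx
      have hBy : ‖inChart φ θ.1 y‖ ≤ B := by
        simpa only [norm_iteratedFDeriv_zero] using hB 0 le_rfl y hy
      refine (hC θ.1 y hy v).trans ?_
      gcongr
    · rw [hsupp x hx]
      exact (norm_zero (E := ℂ)).le.trans (mul_nonneg (mul_nonneg hC0 hB0) h0)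
  let T : Current k M 2 1 1 :=
    { toFun :=
        { toFun := fun θ => T' (toCont θ)
          map_add' := fun θ θ' => T'.map_add (toCont θ) (toCont θ')
          map_smul' := fun c θ => T'.map_smul c (toCont θ) }
      continuous' := fun φ hφ K hK hKc => by
        obtain ⟨C, hC⟩ := hbound φ hφ K hK hKc
        exact ⟨0, C, fun B θ hθ => hC B (toCont θ) hθ⟩ }
  refine ⟨T, fun θ hθ => hpos (toCont θ) hθ, hmass, fun j => ⟨T', ⟨fun θ => rfl, hbound⟩,
    fun β => ?_⟩, fun u hu => hexact _ ⟨u, hu, rfl⟩⟩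
  -- `α j ∧ β` vanishes on the common kernel, where it is therefore dominated by `0 • Ω`.
  refine norm_le_zero_iff.1 (hle _ 0 fun x v hv => ?_)
  rw [zero_mul, norm_le_zero_iff]
  exact wedge_apply_smul_I_eq_zero ((α j).2.1 x) (hv j)
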